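/- Let $E,F\subset\mathbb{R}^2$ be connected sets, each containing more than one point. If $F$ is compact and is not a line segment (that is, there are no $a,b\in\mathbb{R}^2$ with $F=\{(1-t)a+tb : 0\le t\le 1\}$), then the arithmetic sum $E+F=\{x+y : x\in E,\ y\in F\}$ has non-empty interior in $\mathbb{R}^2$. -/

import Mathlib

open scoped Pointwise

/-! Suppose `E + F` has empty interior and put `G = -F`. Then `z + G` misses `E` for a dense set of
`z`. Since `F` is not a segment it has three non-collinear points. Chains of translates of `F` in
two independent directions must cross, so countably many translates of `F - F` cover the plane, and
Baire gives `F - F` interior (`IsCompact.interior_sub_self_nonempty`).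

Pick `w` in that interior, not parallel to `p - q` with `p, q ∈ E`. Translates of `G` by points near
`t + k • w`, `k ∈ ℤ`, overlap consecutively and form a barrier across the plane. By density the
barrier can be perturbed to miss `E`; by connectedness, if `p` can escape upwards then so can `q`,
and shifting everything by `p - q` returns `q` to `p`. Iterating lifts the barrier from below `p` to
above it while `p` still escapes, which is absurd (`not_dense_setOf_disjoint_vadd`). -/

/-! ### Crossing paths, by a winding number. -/

/-- Along a path in the slit plane, a continuous logarithm differs from the principal one by a
constant. -/
theorem Complex.sub_log_const_of_exp_eq {u g : ℝ → ℂ} (hu : Continuous u) (hg : Continuous g)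
    (hs : ∀ x, g x ∈ Complex.slitPlane) (h : ∀ x, Complex.exp (u x) = g x) (x y : ℝ) :
    u x - Complex.log (g x) = u y - Complex.log (g y) := by
  have hc : Continuous fun x => u x - Complex.log (g x) := hu.sub (hg.clog hs)
  refine Complex.isCoveringMap_exp.const_of_comp hc (fun a a' => ?_) x y
  have key : ∀ a, Complex.exp (u a - Complex.log (g a)) = 1 := fun a => by
    have h0 := Complex.slitPlane_ne_zero (hs a)
    rw [Complex.exp_sub, h, Complex.exp_log h0, div_self h0]
  exact Subtype.ext ((key a).trans (key a').symm)

/-- A path crossing a region from left to right meets a path crossing it from bottom to top. -/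
theorem Complex.exists_eq_of_crossing {α β : ℝ → ℂ} (hα : Continuous α) (hβ : Continuous β)
    (hl : ∀ t, (α 0).re < (β t).re) (hr : ∀ t, (β t).re < (α 1).re)
    (hb : ∀ s, (β 0).im < (α s).im) (ht : ∀ s, (α s).im < (β 1).im) :
    ∃ s t, α s = β t := by
  by_contra! hne
  have hc : Continuous fun x : ℝ × ℝ => α x.1 - β x.2 := by fun_prop
  have h0 : ∀ x : ℝ × ℝ, α x.1 - β x.2 ≠ 0 := fun x => sub_ne_zero.2 (hne _ _)
  -- The parameter plane is simply connected, so the nonvanishing difference has a continuous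
  -- logarithm on it.
  obtain ⟨L, ⟨-, hL⟩, -⟩ := Complex.isCoveringMapOn_exp.existsUnique_continuousMap_lifts
    (A := ℝ × ℝ) ⟨_, hc⟩ (a₀ := (0, 0)) (Complex.exp_log (h0 (0, 0))) h0
  have hL' : ∀ s t, Complex.exp (L (s, t)) = α s - β t := fun s t => congrFun hL (s, t)
  have bot := Complex.sub_log_const_of_exp_eq (u := fun s => L (s, 0)) (by fun_prop)
    (hα.sub continuous_const) (fun s => Or.inr (by simpa [sub_eq_zero] using (hb s).ne'))
    (fun s => hL' s 0) 0 1
  have right := Complex.sub_log_const_of_exp_eq (u := fun t => L (1, t)) (by fun_prop)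
    (continuous_const.sub hβ) (fun t => Or.inl (by simpa using hr t))
    (fun t => hL' 1 t) 0 1
  have top := Complex.sub_log_const_of_exp_eq (u := fun s => L (s, 1)) (by fun_prop)
    (hα.sub continuous_const) (fun s => Or.inr (by simpa [sub_eq_zero] using (ht s).ne))
    (fun s => hL' s 1) 0 1
  -- On this side the difference has negative real part and may cross the cut, so its negative is
  -- used. The corrections by `π * I` have opposite signs at the two ends and add up to one full
  -- turn around the square.
  have left := Complex.sub_log_const_of_exp_eq
    (u := fun t => L (0, t) + Real.pi * Complex.I) (g := fun t => -(α 0 - β t)) (by fun_prop)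
    (by fun_prop) (fun t => Or.inl (by simpa using hl t))
    (fun t => by simp [Complex.exp_add, hL']) 0 1
  have e0 : Complex.log (-(α 0 - β 0)) = Complex.log (α 0 - β 0) - Real.pi * Complex.I := by
    rw [Complex.log, Complex.log, norm_neg, Complex.arg_neg_eq_arg_sub_pi_of_im_pos (by simpa using hb 0)]
    simp [sub_mul, add_sub_assoc]
  have e1 : Complex.log (-(α 0 - β 1)) = Complex.log (α 0 - β 1) + Real.pi * Complex.I := by
    rw [Complex.log, Complex.log, norm_neg, Complex.arg_neg_eq_arg_add_pi_of_im_neg (by simpa using ht 0)]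
    simp [add_mul, add_assoc]
  simp only [e0, e1] at left
  have : (2 * Real.pi * Complex.I : ℂ) = 0 := by
    linear_combination left - bot - right + top
  exact Complex.two_pi_I_ne_zero this

/-! ### Crossing continua. -/

section Plane

variable {V : Type*} [NormedAddCommGroup V] [NormedSpace ℝ V]

theorem IsOpen.joinedIn_of_isPreconnected {U s : Set V} (hU : IsOpen U) (hs : IsPreconnected s)
    (hsU : s ⊆ U) {x y : V} (hx : x ∈ s) (hy : y ∈ s) : JoinedIn U x y := by
  have hc : IsConnected (connectedComponentIn U x) :=
    isConnected_connectedComponentIn_iff.2 (hsU hx)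
  have hp := (hU.connectedComponentIn.isConnected_iff_isPathConnected).1 hc
  exact (hp.joinedIn x (mem_connectedComponentIn (hsU hx)) y
    (hs.subset_connectedComponentIn hx hsU hy)).mono (connectedComponentIn_subset U x)

/-- Two compact connected sets in the plane, one crossing the other in the direction `f` and being
crossed by it in the direction `h`, intersect. -/
theorem IsCompact.inter_nonempty_of_crossing {f h : V →L[ℝ] ℝ}
    (hfh : ∀ x, f x = 0 → h x = 0 → x = 0) {K L : Set V} (hK : IsCompact K) (hL : IsCompact L)
    (hKc : IsPreconnected K) (hLc : IsPreconnected L) {p p' q q' : V}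
    (hp : p ∈ K) (hp' : p' ∈ K) (hq : q ∈ L) (hq' : q' ∈ L)
    (hl : ∀ x ∈ L, f p < f x) (hr : ∀ x ∈ L, f x < f p')
    (hb : ∀ x ∈ K, h q < h x) (ht : ∀ x ∈ K, h x < h q') :
    (K ∩ L).Nonempty := by
  by_contra hne
  have hd : Disjoint K L := Set.disjoint_iff_inter_eq_empty.2 (Set.not_nonempty_iff_eq_empty.1 hne)
  -- Disjoint open neighbourhoods, cut down to strips that keep the crossing inequalities, allow the
  -- continua to be replaced by paths.
  obtain ⟨A, B, hA, hB, hKA, hLB, hAB⟩ := SeparatedNhds.of_isCompact_isCompact hK hL hd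
  have hA' : IsOpen (A ∩ (h ⁻¹' Set.Ioo (h q) (h q'))) := hA.inter (isOpen_Ioo.preimage h.continuous)
  have hB' : IsOpen (B ∩ (f ⁻¹' Set.Ioo (f p) (f p'))) := hB.inter (isOpen_Ioo.preimage f.continuous)
  obtain ⟨γ, hγ⟩ := hA'.joinedIn_of_isPreconnected hKc
    (fun x hx => ⟨hKA hx, hb x hx, ht x hx⟩) hp hp'
  obtain ⟨δ, hδ⟩ := hB'.joinedIn_of_isPreconnected hLc
    (fun x hx => ⟨hLB hx, hl x hx, hr x hx⟩) hq hq'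
  have hγ' : ∀ s, γ.extend s ∈ A ∩ (h ⁻¹' Set.Ioo (h q) (h q')) := fun s => hγ _
  have hδ' : ∀ s, δ.extend s ∈ B ∩ (f ⁻¹' Set.Ioo (f p) (f p')) := fun s => hδ _
  have Tre : ∀ x, (f x + h x * Complex.I : ℂ).re = f x := by simp
  have Tim : ∀ x, (f x + h x * Complex.I : ℂ).im = h x := by simp
  obtain ⟨s, t, hst⟩ := Complex.exists_eq_of_crossing
    (α := fun s => f (γ.extend s) + h (γ.extend s) * Complex.I)
    (β := fun s => f (δ.extend s) + h (δ.extend s) * Complex.I) (by fun_prop) (by fun_prop)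
    (fun t => by rw [Tre, Tre, γ.extend_zero]; exact (hδ' t).2.1)
    (fun t => by rw [Tre, Tre, γ.extend_one]; exact (hδ' t).2.2)
    (fun t => by rw [Tim, Tim, δ.extend_zero]; exact (hγ' t).2.1)
    (fun t => by rw [Tim, Tim, δ.extend_one]; exact (hγ' t).2.2)
  have h1 := congrArg Complex.re hst
  have h2 := congrArg Complex.im hst
  simp only [Tre, Tim] at h1 h2
  have := hfh (γ.extend s - δ.extend t) (by simp [h1]) (by simp [h2])
  exact hAB.le_bot ⟨(hγ' s).1, by rw [sub_eq_zero.1 this]; exact (hδ' t).1⟩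

end Plane

theorem Set.vadd_inter_vadd_nonempty {A : Type*} [AddCommGroup A] {G : Set A} {u v : A}
    (h : v - u ∈ G - G) : ((u +ᵥ G) ∩ (v +ᵥ G)).Nonempty := by
  obtain ⟨g, hg, g', hg', he⟩ := Set.mem_sub.1 h
  refine ⟨u + g, Set.mem_vadd_set.2 ⟨g, hg, rfl⟩, Set.mem_vadd_set.2 ⟨g', hg', ?_⟩⟩
  rw [vadd_eq_add, ← sub_eq_zero, ← sub_eq_zero.2 he.symm]
  abel

theorem norm_sub_le_of_mem_vadd {A : Type*} [NormedAddCommGroup A] {G : Set A} {r : ℝ}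
    (hr : ∀ g ∈ G, ‖g‖ ≤ r) {u v x : A} {R : ℝ}
    (hu : ‖u - v‖ ≤ R) (hx : x ∈ u +ᵥ G) : ‖x - v‖ ≤ R + r := by
  obtain ⟨g, hg, rfl⟩ := Set.mem_vadd_set.1 hx
  have : u + g - v = (u - v) + g := by abel
  rw [vadd_eq_add, this]
  exact (norm_add_le _ _).trans (add_le_add hu (hr g hg))

/-! ### Chains of translates and the difference set. -/

section Chain

variable {V : Type*} [NormedAddCommGroup V] [NormedSpace ℝ V]

theorem abs_sub_le_of_norm_sub_smul_le {f : V →L[ℝ] ℝ} {w x : V} {c : ℝ} {k : ℤ} {R : ℝ}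
    (hw : f w = c) (hx : ‖x - k • w‖ ≤ R) : |f x - k * c| ≤ ‖f‖ * R := by
  have h1 := (f.le_opNorm (x - k • w)).trans (mul_le_mul_of_nonneg_left hx (norm_nonneg f))
  rwa [map_sub, map_zsmul, hw, zsmul_eq_mul, Real.norm_eq_abs] at h1

/-- On `S k` the functional `f` is within a fixed distance of `k`, so a bounded range of `f` meets
only finitely many pieces. -/
theorem isClosed_iUnion_of_norm_sub_smul_le {S : ℤ → Set V} (hS : ∀ k, IsClosed (S k))
    {f : V →L[ℝ] ℝ} {w : V} (hw : f w = 1) {R : ℝ}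
    (hR : ∀ k, ∀ x ∈ S k, ‖x - k • w‖ ≤ R) : IsClosed (⋃ k, S k) := by
  refine LocallyFinite.isClosed_iUnion (fun x => ?_) hS
  refine ⟨f ⁻¹' Set.Ioo (f x - 1) (f x + 1), (isOpen_Ioo.preimage f.continuous).mem_nhds (by simp),
    (Set.finite_Icc ⌊f x - 1 - ‖f‖ * R⌋ ⌈f x + 1 + ‖f‖ * R⌉).subset ?_⟩
  rintro k ⟨y, hy, hy1, hy2⟩
  have h1 := abs_le.1 (abs_sub_le_of_norm_sub_smul_le hw (hR k y hy))
  rw [mul_one] at h1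
  constructor
  · exact (Int.cast_le (R := ℝ)).1 ((Int.floor_le _).trans (by linarith [h1.1]))
  · exact (Int.cast_le (R := ℝ)).1 (le_trans (by linarith [h1.2]) (Int.le_ceil _))

/-- A compact connected set in the plane reaching from below to above a chain of compact connected
sets which progresses in the direction `w` meets this chain. -/
theorem IsCompact.inter_iUnion_nonempty {f h : V →L[ℝ] ℝ}
    (hfh : ∀ x, f x = 0 → h x = 0 → x = 0) {S : ℤ → Set V} (hS : ∀ k, IsCompact (S k))
    (hSc : ∀ k, IsPreconnected (S k)) (hi : ∀ k, (S k ∩ S (k + 1)).Nonempty)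
    {w : V} (hw : f w = 1) {R : ℝ} (hR : ∀ k, ∀ x ∈ S k, ‖x - k • w‖ ≤ R)
    {L : Set V} (hL : IsCompact L) (hLc : IsPreconnected L) {q q' : V} (hq : q ∈ L) (hq' : q' ∈ L)
    (hb : ∀ k, ∀ x ∈ S k, h q < h x) (ht : ∀ k, ∀ x ∈ S k, h x < h q') :
    (L ∩ ⋃ k, S k).Nonempty := by
  obtain ⟨r, hr⟩ := (hL.image f.continuous).isBounded.exists_norm_le
  replace hr : ∀ x ∈ L, |f x| ≤ r := fun x hx => hr _ (Set.mem_image_of_mem f hx)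
  -- Far enough that `S (-N)` and `S N` lie on opposite sides of `L`.
  obtain ⟨N, hN⟩ := exists_nat_gt (r + ‖f‖ * R)
  have hf : ∀ k, ∀ x ∈ S k, |f x - k| ≤ ‖f‖ * R := fun k x hx => by
    simpa using abs_sub_le_of_norm_sub_smul_le hw (hR k x hx)
  obtain ⟨p, hp, -⟩ := hi (-N)
  obtain ⟨p', hp', -⟩ := hi N
  have hfp := abs_le.1 (hf _ p hp)
  have hfp' := abs_le.1 (hf _ p' hp')
  push_cast at hfp hfp'
  have hm : ∀ {k : ℤ} {x : V}, k ∈ Set.Icc (-N : ℤ) N → x ∈ S k →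
      x ∈ ⋃ k ∈ Set.Icc (-N : ℤ) N, S k := fun hk hx => Set.mem_biUnion hk hx
  obtain ⟨x, hx, hxL⟩ := IsCompact.inter_nonempty_of_crossing hfh
    ((Set.finite_Icc (-N : ℤ) N).isCompact_biUnion fun k _ => hS k) hL
    (IsPreconnected.biUnion_of_chain Set.ordConnected_Icc (fun k _ => hSc k) fun k _ _ => hi k) hLc (hm (by simp) hp) (hm (by simp) hp') hq hq'
    (fun x hx => by linarith [abs_le.1 (hr x hx)]) (fun x hx => by linarith [abs_le.1 (hr x hx)])
    (fun x hx => by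
      obtain ⟨k, -, hk⟩ := Set.mem_iUnion₂.1 hx
      exact hb k x hk)
    (fun x hx => by
      obtain ⟨k, -, hk⟩ := Set.mem_iUnion₂.1 hx
      exact ht k x hk)
  obtain ⟨k, -, hk⟩ := Set.mem_iUnion₂.1 hx
  exact ⟨x, hxL, Set.mem_iUnion.2 ⟨k, hk⟩⟩

/-- The difference set of a continuum in the plane containing three affinely independent points has
nonempty interior. -/
theorem IsCompact.interior_sub_self_nonempty [CompleteSpace V] {f h : V →L[ℝ] ℝ}
    (hfh : ∀ x, f x = 0 → h x = 0 → x = 0) {G : Set V} (hG : IsCompact G) (hGc : IsPreconnected G)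
    {a b c : V} (ha : a ∈ G) (hb : b ∈ G) (hc : c ∈ G) (hfb : f (b - a) = 1) (hhb : h (b - a) = 0)
    (hhc : h (c - a) = 1) : (interior (G - G)).Nonempty := by
  obtain ⟨r, hr⟩ := hG.isBounded.exists_norm_le
  have hcon : ∀ u : V, IsPreconnected (u +ᵥ G) := fun u =>
    hGc.image (u +ᵥ ·) (continuous_const_vadd u).continuousOn
  have hcomp : ∀ u : V, IsCompact (u +ᵥ G) := fun u => hG.vadd u
  have hint : ∀ u : V, ∀ d ∈ G, ∀ k : ℤ,
      (((u + k • (d - a)) +ᵥ G) ∩ ((u + (k + 1) • (d - a)) +ᵥ G)).Nonempty := fun u d hd k =>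
    Set.vadd_inter_vadd_nonempty ⟨d, hd, a, ha, by simp only [add_smul, one_smul]; abel⟩
  -- A chain through the origin in direction `b - a` meets one through `x` in direction `c - a`; a
  -- common point writes `x` as a lattice vector plus a difference of points of `G`.
  have hcover : ⋃ n : ℤ × ℤ, (n.1 • (b - a) + n.2 • (c - a)) +ᵥ (G - G) = Set.univ := by
    refine Set.eq_univ_of_forall fun x => ?_
    have hL : ∀ l : ℤ, ∀ y ∈ (x + l • (c - a)) +ᵥ G, |h y - l| ≤ ‖h‖ * (‖x‖ + r) :=
      fun l y hy => by
        simpa using abs_sub_le_of_norm_sub_smul_le hhc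
          (norm_sub_le_of_mem_vadd hr (v := l • (c - a)) (R := ‖x‖) (by simp) hy)
    have hS : ∀ k : ℤ, ∀ y ∈ (0 + k • (b - a)) +ᵥ G, ‖y - k • (b - a)‖ ≤ 0 + r :=
      fun k y hy => norm_sub_le_of_mem_vadd hr (by simp) hy
    have hSh : ∀ k : ℤ, ∀ y ∈ (0 + k • (b - a)) +ᵥ G, |h y| ≤ ‖h‖ * r := fun k y hy => by
      simpa using abs_sub_le_of_norm_sub_smul_le hhb (hS k y hy)
    obtain ⟨M, hM⟩ := exists_nat_gt (‖h‖ * r + ‖h‖ * (‖x‖ + r))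
    obtain ⟨q, hq, -⟩ := hint x c hc (-M)
    obtain ⟨q', hq', -⟩ := hint x c hc M
    have hhq := abs_le.1 (hL _ q hq)
    have hhq' := abs_le.1 (hL _ q' hq')
    push_cast at hhq hhq'
    obtain ⟨y, hyL, hyS⟩ := IsCompact.inter_iUnion_nonempty hfh (fun k => hcomp (0 + k • (b - a)))
      (fun k => hcon _) (hint 0 b hb) hfb hS
      ((Set.finite_Icc (-M : ℤ) M).isCompact_biUnion fun l _ => hcomp (x + l • (c - a)))
      (IsPreconnected.biUnion_of_chain Set.ordConnected_Icc (fun l _ => hcon _)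
        fun l _ _ => hint x c hc l)
      (Set.mem_biUnion (by simp) hq) (Set.mem_biUnion (by simp) hq')
      (fun k y hy => by linarith [abs_le.1 (hSh k y hy)])
      (fun k y hy => by linarith [abs_le.1 (hSh k y hy)])
    obtain ⟨l, -, hl⟩ := Set.mem_iUnion₂.1 hyL
    obtain ⟨k, hk⟩ := Set.mem_iUnion.1 hyS
    obtain ⟨g, hg, hgy⟩ := Set.mem_vadd_set.1 hk
    obtain ⟨g', hg', hgy'⟩ := Set.mem_vadd_set.1 hl
    refine Set.mem_iUnion.2 ⟨(k, -l), Set.mem_vadd_set.2 ⟨g - g', Set.sub_mem_sub hg hg', ?_⟩⟩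
    simp only [vadd_eq_add, zero_add] at hgy hgy' ⊢
    rw [neg_smul, ← sub_eq_zero, ← sub_eq_zero.2 (hgy.trans hgy'.symm)]
    abel
  obtain ⟨n, hn⟩ := nonempty_interior_of_iUnion_of_closed
    (fun n : ℤ × ℤ => ((sub_eq_add_neg G G ▸ hG.add hG.neg : IsCompact (G - G)).vadd (n.1 • (b - a) + n.2 • (c - a))).isClosed) hcover
  rw [interior_vadd] at hn
  exact Set.vadd_set_nonempty.1 hn

end Chain

/-! ### Escaping above a moving barrier. -/

section Above

variable {V : Type*} [NormedAddCommGroup V] [NormedSpace ℝ V]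

/-- The point `x` can be joined in the complement of `C` to points at arbitrarily large height,
where height is measured by the functional `h`. -/
def ReachesAbove (h : V →L[ℝ] ℝ) (C : Set V) (x : V) : Prop :=
  ∀ M : ℝ, ∃ y, M < h y ∧ JoinedIn Cᶜ x y

/-- The union of the translates of `G` by the terms of the sequence `z`. -/
def translateChain (G : Set V) (z : ℤ → V) : Set V := ⋃ k, z k +ᵥ G

variable {h : V →L[ℝ] ℝ} {C G E : Set V} {x y : V}

theorem JoinedIn.reachesAbove (hxy : JoinedIn Cᶜ x y) (hy : ReachesAbove h C y) :
    ReachesAbove h C x := fun M => by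
  obtain ⟨z, hz, hj⟩ := hy M
  exact ⟨z, hz, hxy.trans hj⟩

theorem reachesAbove_of_forall_lt {u : V} (hu : h u = 1) (hC : ∀ c ∈ C, h c < h x) :
    ReachesAbove h C x := fun M => by
  refine ⟨x + (|M - h x| + 1) • u, ?_, JoinedIn.of_segment_subset ?_⟩
  · rw [map_add, map_smul, hu, smul_eq_mul]
    linarith [le_abs_self (M - h x)]
  · have hconv : Convex ℝ (h ⁻¹' Set.Ici (h x)) := (convex_Ici _).linear_preimage h.toLinearMap
    refine (hconv.segment_subset (by simp) ?_).trans fun c hc hcC => (hC c hcC).not_ge hc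
    rw [Set.mem_preimage, map_add, map_smul, hu, smul_eq_mul, Set.mem_Ici]
    linarith [abs_nonneg (M - h x)]

theorem ReachesAbove.of_isPreconnected (hy : ReachesAbove h C y) (hC : IsClosed C)
    (hE : IsPreconnected E) (hd : Disjoint E C) (hxE : x ∈ E) (hyE : y ∈ E) :
    ReachesAbove h C x :=
  (hC.isOpen_compl.joinedIn_of_isPreconnected hE hd.subset_compl_right hxE hyE).reachesAbove hy

theorem ReachesAbove.translateChain_add_const {z : ℤ → V}
    (hx : ReachesAbove h (translateChain G z) x) (e : V) :
    ReachesAbove h (translateChain G fun k => z k + e) (x + e) := fun M => by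
  obtain ⟨y, hy, hj⟩ := hx (M - h e)
  refine ⟨y + e, by rw [map_add]; linarith, (hj.map (continuous_add_const e)).mono ?_⟩
  rintro _ ⟨c, hc, rfl⟩ hc'
  obtain ⟨k, hk⟩ := Set.mem_iUnion.1 hc'
  obtain ⟨g, hg, hgc⟩ := Set.mem_vadd_set.1 hk
  refine hc (Set.mem_iUnion.2 ⟨k, Set.mem_vadd_set.2 ⟨g, hg, ?_⟩⟩)
  refine add_right_cancel (b := e) (Eq.trans ?_ hgc)
  simp only [vadd_eq_add]
  abel

theorem isClosed_translateChain (hG : IsCompact G) {f : V →L[ℝ] ℝ} {w : V} (hw : f w = 1)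
    {z : ℤ → V} {R : ℝ} (hz : ∀ k, ‖z k - k • w‖ ≤ R) : IsClosed (translateChain G z) := by
  obtain ⟨r, hr⟩ := hG.isBounded.exists_norm_le
  exact isClosed_iUnion_of_norm_sub_smul_le (fun k => (hG.vadd (z k)).isClosed) hw
    (fun k x hx => norm_sub_le_of_mem_vadd hr (hz k) hx)

/-- Reaching above a chain is stable under uniformly small perturbations of the chain. -/
theorem ReachesAbove.exists_forall_norm_sub_lt (hG : IsCompact G) {f : V →L[ℝ] ℝ} {w u : V}
    (hw : f w = 1) (hhw : h w = 0) (hu : h u = 1) {z : ℤ → V} {R : ℝ}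
    (hz : ∀ k, ‖z k - k • w‖ ≤ R) (hx : ReachesAbove h (translateChain G z) x) :
    ∃ δ > 0, ∀ z' : ℤ → V, (∀ k, ‖z' k - z k‖ < δ) → ReachesAbove h (translateChain G z') x := by
  obtain ⟨r, hr⟩ := hG.isBounded.exists_norm_le
  -- This height exceeds that of every chain within distance `1` of `z`, so from `y` a straight ray
  -- finishes the escape.
  obtain ⟨y, hy, γ, hγ⟩ := hx (‖h‖ * (1 + R + r))
  have hd : Disjoint (Set.range γ) (translateChain G z) :=
    Set.disjoint_left.2 (by rintro _ ⟨t, rfl⟩; exact hγ t)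
  obtain ⟨δ, hδ, hdis⟩ := hd.exists_thickenings (isCompact_range γ.continuous)
    (isClosed_translateChain hG hw hz)
  refine ⟨min δ 1, by positivity, fun z' hz' => ?_⟩
  have hxy : JoinedIn (translateChain G z')ᶜ x y := by
    refine ⟨γ, fun t ht => ?_⟩
    obtain ⟨k, hk⟩ := Set.mem_iUnion.1 ht
    obtain ⟨g, hg, hgt⟩ := Set.mem_vadd_set.1 hk
    refine Set.disjoint_left.1 hdis (Metric.self_subset_thickening hδ _ ⟨t, rfl⟩)
      (Metric.mem_thickening_iff.2 ⟨z k + g, Set.mem_iUnion.2 ⟨k, g, hg, rfl⟩, ?_⟩)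
    rw [← hgt, vadd_eq_add, dist_add_right, dist_eq_norm]
    exact (hz' k).trans_le (min_le_left _ _)
  refine hxy.reachesAbove (reachesAbove_of_forall_lt hu fun c hc => ?_)
  obtain ⟨k, hk⟩ := Set.mem_iUnion.1 hc
  have hz'' : ‖z' k - k • w‖ ≤ 1 + R :=
    calc ‖z' k - k • w‖ = ‖(z' k - z k) + (z k - k • w)‖ := by congr 1; abel
      _ ≤ 1 + R := (norm_add_le _ _).trans
        (add_le_add ((hz' k).le.trans (min_le_right _ _)) (hz k))
  have := abs_sub_le_of_norm_sub_smul_le hhw (norm_sub_le_of_mem_vadd hr hz'' hk)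
  rw [mul_zero, sub_zero] at this
  exact (le_of_abs_le this).trans_lt hy

theorem not_reachesAbove_translateChain {f : V →L[ℝ] ℝ} (hfh : ∀ x, f x = 0 → h x = 0 → x = 0)
    (hG : IsCompact G) (hGc : IsPreconnected G) {w : V} (hw : f w = 1) (hhw : h w = 0)
    {z : ℤ → V} {R : ℝ} (hz : ∀ k, ‖z k - k • w‖ ≤ R) (hzG : ∀ k, z (k + 1) - z k ∈ G - G)
    (hx : ∀ c ∈ translateChain G z, h x < h c) : ¬ ReachesAbove h (translateChain G z) x := by
  intro ha
  obtain ⟨r, hr⟩ := hG.isBounded.exists_norm_le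
  obtain ⟨y, hy, γ, hγ⟩ := ha (‖h‖ * (R + r))
  have hS : ∀ k, ∀ x ∈ z k +ᵥ G, ‖x - k • w‖ ≤ R + r := fun k x hx =>
    norm_sub_le_of_mem_vadd hr (hz k) hx
  obtain ⟨c, ⟨t, rfl⟩, hc⟩ := IsCompact.inter_iUnion_nonempty hfh (fun k => hG.vadd (z k))
    (fun k => hGc.image (z k +ᵥ ·) (continuous_const_vadd (z k)).continuousOn)
    (fun k => Set.vadd_inter_vadd_nonempty (hzG k)) hw hS (isCompact_range γ.continuous)
    (isPreconnected_range γ.continuous) ⟨0, γ.source⟩ ⟨1, γ.target⟩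
    (fun k c hc => hx c (Set.mem_iUnion.2 ⟨k, hc⟩))
    (fun k c hc => by
      have := abs_sub_le_of_norm_sub_smul_le hhw (hS k c hc)
      rw [mul_zero, sub_zero] at this
      exact (le_of_abs_le this).trans_lt hy)
  exact hγ t hc

/-- If `w` is an interior point of `G - G`, then a dense set of translates of the planar continuum
`G` cannot avoid a connected set containing two points whose difference is not parallel to `w`. -/
theorem not_dense_setOf_disjoint_vadd {f : V →L[ℝ] ℝ} (hfh : ∀ x, f x = 0 → h x = 0 → x = 0)
    (hE : IsPreconnected E) {p q : V} (hp : p ∈ E) (hq : q ∈ E) (hG : IsCompact G)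
    (hGc : IsPreconnected G) {w : V} (hw : f w = 1) (hhw : h w = 0) (hpq : h (p - q) = 1)
    (hwG : w ∈ interior (G - G)) : ¬ Dense {z : V | Disjoint E (z +ᵥ G)} := by
  intro hD
  obtain ⟨r, hr⟩ := hG.isBounded.exists_norm_le
  obtain ⟨ε, hε, hball⟩ := Metric.isOpen_iff.1 isOpen_interior w hwG
  -- Quantifying over all `δ` leaves room for a fresh perturbation at each shift.
  let P : V → Prop := fun t => ∀ δ > 0, ∃ z : ℤ → V, (∀ k, ‖z k - (t + k • w)‖ < δ) ∧
    ReachesAbove h (translateChain G z) p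
  have hnorm : ∀ {t : V} {δ : ℝ} {z : ℤ → V}, (∀ k, ‖z k - (t + k • w)‖ < δ) →
      ∀ k, ‖z k - k • w‖ ≤ δ + ‖t‖ := fun {t δ z} hz k =>
    calc ‖z k - k • w‖ = ‖(z k - (t + k • w)) + t‖ := by congr 1; abel
      _ ≤ δ + ‖t‖ := (norm_add_le _ _).trans (add_le_add_left (hz k).le _)
  have step : ∀ t, P t → P (t + (p - q)) := by
    intro t ht δ hδ
    obtain ⟨z, hz, hzp⟩ := ht (δ / 2) (by positivity)
    obtain ⟨δ', hδ', hstab⟩ := hzp.exists_forall_norm_sub_lt hG hw hhw hpq (hnorm hz)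
    choose z' hz'D hz' using fun k => hD.exists_dist_lt (z k) (lt_min hδ' (half_pos hδ))
    replace hz' : ∀ k, ‖z' k - z k‖ < min δ' (δ / 2) := fun k => by
      rw [← dist_eq_norm, dist_comm]; exact hz' k
    have hz't : ∀ k, ‖z' k - (t + k • w)‖ < δ := fun k =>
      calc ‖z' k - (t + k • w)‖ = ‖(z' k - z k) + (z k - (t + k • w))‖ := by congr 1; abel
        _ < δ / 2 + δ / 2 := (norm_add_le _ _).trans_lt
          (add_lt_add ((hz' k).trans_le (min_le_right _ _)) (hz k))
        _ = δ := add_halves δ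
    have hz'q : ReachesAbove h (translateChain G z') q :=
      (hstab z' fun k => (hz' k).trans_le (min_le_left _ _)).of_isPreconnected
        (isClosed_translateChain hG hw (hnorm hz't)) hE (Set.disjoint_iUnion_right.2 hz'D) hq hp
    refine ⟨_, fun k => ?_, by simpa using hz'q.translateChain_add_const (p - q)⟩
    convert hz't k using 2
    abel
  have steps : ∀ t, P t → ∀ n : ℕ, P (t + n • (p - q)) := by
    intro t ht n
    induction n with
    | zero => simpa using ht
    | succ n ih => rw [succ_nsmul, ← add_assoc]; exact step _ ih
  -- Chains near `-N • (p - q)` lie below `p`, those near `N • (p - q)` above it.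
  obtain ⟨N, hN⟩ := exists_nat_gt (‖h‖ * (ε / 2 + r) + |h p|)
  have hheight : ∀ {t : V} {δ : ℝ} {z : ℤ → V}, (∀ k, ‖z k - (t + k • w)‖ < δ) →
      ∀ c ∈ translateChain G z, |h c - h t| ≤ ‖h‖ * (δ + r) := fun {t δ z} hz c hc => by
    obtain ⟨k, hk⟩ := Set.mem_iUnion.1 hc
    have := abs_sub_le_of_norm_sub_smul_le (k := 1) (f := h) (w := t + k • w) rfl
      ((one_smul ℤ (t + k • w)).symm ▸ norm_sub_le_of_mem_vadd hr (hz k).le hk)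
    simpa [hhw] using this
  have start : P (-(N • (p - q))) := by
    intro δ hδ
    have h0 : ∀ k : ℤ, ‖(-(N • (p - q)) + k • w) - (-(N • (p - q)) + k • w)‖ < ε / 2 := fun k => by
      rw [sub_self, norm_zero]; exact half_pos hε
    refine ⟨fun k => -(N • (p - q)) + k • w, fun k => by rw [sub_self, norm_zero]; exact hδ,
      reachesAbove_of_forall_lt hpq fun c hc => ?_⟩
    have h1 := (abs_le.1 (hheight h0 c hc)).2
    rw [map_neg, map_nsmul, hpq, nsmul_one] at h1
    linarith [neg_abs_le (h p)]
  have top : P (N • (p - q)) := by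
    have := steps _ start (N + N)
    rwa [add_nsmul, neg_add_cancel_left] at this
  obtain ⟨z, hz, hzp⟩ := top (ε / 2) (half_pos hε)
  refine not_reachesAbove_translateChain hfh hG hGc hw hhw (hnorm hz) (fun k => ?_)
    (fun c hc => ?_) hzp
  · refine interior_subset (hball ?_)
    rw [Metric.mem_ball, dist_eq_norm]
    calc ‖z (k + 1) - z k - w‖
        = ‖(z (k + 1) - (N • (p - q) + (k + 1) • w)) - (z k - (N • (p - q) + k • w))‖ := by
          congr 1
          rw [add_smul, one_smul]
          abel
      _ < ε / 2 + ε / 2 := (norm_sub_le _ _).trans_lt (add_lt_add (hz _) (hz _))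
      _ = ε := add_halves ε
  · have h1 := (abs_le.1 (hheight hz c hc)).1
    rw [map_nsmul, hpq, nsmul_one] at h1
    linarith [le_abs_self (h p)]

end Above

/-! ### Coordinates in the plane, and the conclusion. -/

section Euclidean

/-- Two vectors of nonzero determinant in the plane have a dual basis. -/
theorem EuclideanSpace.exists_dual_pair {v u : EuclideanSpace ℝ (Fin 2)}
    (hd : v 0 * u 1 - v 1 * u 0 ≠ 0) : ∃ f h : EuclideanSpace ℝ (Fin 2) →L[ℝ] ℝ,
      f v = 1 ∧ h v = 0 ∧ h u = 1 ∧ ∀ x, f x = 0 → h x = 0 → x = 0 := by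
  set d := v 0 * u 1 - v 1 * u 0 with hdef
  let π : Fin 2 → EuclideanSpace ℝ (Fin 2) →L[ℝ] ℝ := EuclideanSpace.proj
  have hf : ∀ x, (d⁻¹ • (u 1 • π 0 - u 0 • π 1)) x = d⁻¹ * (u 1 * x 0 - u 0 * x 1) := fun x => rfl
  have hh : ∀ x, (d⁻¹ • (v 0 • π 1 - v 1 • π 0)) x = d⁻¹ * (v 0 * x 1 - v 1 * x 0) := fun x => rfl
  refine ⟨d⁻¹ • (u 1 • π 0 - u 0 • π 1), d⁻¹ • (v 0 • π 1 - v 1 • π 0), ?_, ?_, ?_, ?_⟩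
  · rw [hf, inv_mul_eq_one₀ hd]; ring
  · rw [hh]; ring
  · rw [hh, inv_mul_eq_one₀ hd]
  · intro x h1 h2
    rw [hf, mul_eq_zero_iff_left (inv_ne_zero hd)] at h1
    rw [hh, mul_eq_zero_iff_left (inv_ne_zero hd)] at h2
    ext i
    refine (mul_eq_zero_iff_left hd).1 ?_
    fin_cases i
    · simp only [Fin.zero_eta, hdef]; linear_combination v 0 * h1 + u 0 * h2
    · simp only [Fin.mk_one, hdef]; linear_combination v 1 * h1 + u 1 * h2

/-- A planar continuum contained in a line is a segment. -/
theorem IsCompact.exists_eq_segment {F : Set (EuclideanSpace ℝ (Fin 2))} (hF : IsCompact F)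
    (hFc : IsConnected F) {a v : EuclideanSpace ℝ (Fin 2)} (hv : v ≠ 0)
    (h : ∀ c ∈ F, v 0 * (c - a) 1 - v 1 * (c - a) 0 = 0) : ∃ p q, F = segment ℝ p q := by
  -- The parameter of the orthogonal projection onto the line through `a` along `v`.
  let g : EuclideanSpace ℝ (Fin 2) → ℝ :=
    fun c => (v 0 * (c - a) 0 + v 1 * (c - a) 1) / (v 0 ^ 2 + v 1 ^ 2)
  have hg : Continuous g := by fun_prop
  have hn : v 0 ^ 2 + v 1 ^ 2 ≠ 0 := by
    intro h0
    refine hv (PiLp.ext fun i => ?_)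
    fin_cases i
    · simpa using (by nlinarith [sq_nonneg (v 0), sq_nonneg (v 1)] : v 0 ^ 2 = 0)
    · simpa using (by nlinarith [sq_nonneg (v 0), sq_nonneg (v 1)] : v 1 ^ 2 = 0)
  have hgF : ∀ c ∈ F, AffineMap.lineMap a (a + v) (g c) = c := by
    intro c hc
    have h0 := h c hc
    rw [AffineMap.lineMap_apply]
    ext i
    simp only [PiLp.sub_apply] at h0
    fin_cases i
    · simp [g]
      field_simp
      linear_combination v 1 * h0
    · simp [g]
      field_simp
      linear_combination -v 0 * h0
  have hT := eq_Icc_of_connected_compact (hFc.image g hg.continuousOn) (hF.image hg)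
  obtain ⟨c, hc⟩ := hFc.nonempty
  have hle : sInf (g '' F) ≤ sSup (g '' F) := by
    rw [← Set.nonempty_Icc, ← hT]
    exact ⟨_, Set.mem_image_of_mem g hc⟩
  rw [← segment_eq_Icc hle] at hT
  refine ⟨_, _, Eq.trans ?_ (image_segment ℝ (AffineMap.lineMap (k := ℝ) a (a + v))
    (sInf (g '' F)) (sSup (g '' F)))⟩
  rw [← hT, Set.image_image, Set.image_congr hgF, Set.image_id']

end Euclidean

theorem theorem1p1 (E F : Set (EuclideanSpace ℝ (Fin 2)))
    (hE : IsConnected E) (hE' : E.Nontrivial)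
    (hF : IsConnected F) (hF' : F.Nontrivial)
    (hFc : IsCompact F)
    (hFs : ¬ ∃ a b : EuclideanSpace ℝ (Fin 2), F = segment ℝ a b) :
    (interior (E + F)).Nonempty := by
  by_contra hemp
  obtain ⟨p, hp, q, hq, hpq⟩ := hE'
  obtain ⟨a, ha, b, hb, hab⟩ := hF'
  obtain ⟨c, hc, hdet⟩ : ∃ c ∈ F, (b - a) 0 * (c - a) 1 - (b - a) 1 * (c - a) 0 ≠ 0 := by
    by_contra! hall
    exact hFs (hFc.exists_eq_segment hF (sub_ne_zero.2 hab.symm) hall)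
  have hint : (interior (F - F)).Nonempty := by
    obtain ⟨f, h, h1, h2, h3, h4⟩ := EuclideanSpace.exists_dual_pair hdet
    exact hFc.interior_sub_self_nonempty h4 hF.isPreconnected ha hb hc h1 h2 h3
  -- A nonempty open set does not fit in the line spanned by `p - q`.
  obtain ⟨w, hw, hdet'⟩ : ∃ w ∈ interior (F - F), w 0 * (p - q) 1 - w 1 * (p - q) 0 ≠ 0 := by
    by_contra! hall
    let π : Fin 2 → EuclideanSpace ℝ (Fin 2) →ₗ[ℝ] ℝ := fun i => (EuclideanSpace.proj i).toLinearMap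
    let ℓ : EuclideanSpace ℝ (Fin 2) →ₗ[ℝ] ℝ := (p - q) 1 • π 0 - (p - q) 0 • π 1
    have hℓ : ∀ x, ℓ x = (p - q) 1 * x 0 - (p - q) 0 * x 1 := fun x => rfl
    have htop : LinearMap.ker ℓ = ⊤ := Submodule.eq_top_of_nonempty_interior' _
      (hint.mono (interior_maximal (fun x hx => by
        rw [SetLike.mem_coe, LinearMap.mem_ker, hℓ]; linear_combination hall x hx)
        isOpen_interior))
    rw [LinearMap.ker_eq_top] at htop
    refine sub_ne_zero.2 hpq (PiLp.ext fun i => ?_)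
    have h0 := (hℓ (EuclideanSpace.single 0 1)).symm.trans (LinearMap.congr_fun htop _)
    have h1 := (hℓ (EuclideanSpace.single 1 1)).symm.trans (LinearMap.congr_fun htop _)
    fin_cases i
    · simp at h1 ⊢
      linarith
    · simpa using h0
  obtain ⟨f, h, h1, h2, h3, h4⟩ := EuclideanSpace.exists_dual_pair hdet'
  have hFn : IsPreconnected (-F) := by
    rw [← Set.image_neg_eq_neg]
    exact hF.isPreconnected.image _ continuous_neg.continuousOn
  have hdense : Dense (E + F)ᶜ :=
    interior_eq_empty_iff_dense_compl.1 (Set.not_nonempty_iff_eq_empty.1 hemp)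
  refine not_dense_setOf_disjoint_vadd h4 hE.isPreconnected hp hq hFc.neg hFn
    h1 h2 h3 (by rwa [sub_neg_eq_add, neg_add_eq_sub]) ?_
  -- A common point of `E` and `z - F` would put `z` in `E + F`.
  refine hdense.mono ?_
  intro z hz
  refine Set.disjoint_left.2 fun x hx hxz => hz ?_
  obtain ⟨g, hg, hgx⟩ := Set.mem_vadd_set.1 hxz
  exact Set.mem_add.2 ⟨x, hx, -g, hg, by rw [← hgx, vadd_eq_add, add_neg_cancel_right]⟩
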